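/- A proper linear 3-periodic net in $\mathbb{R}^3$ is a pair $\mathcal{N}=(N,S)$ in which $S$ is a countable set of nondegenerate line segments (bonds), any two distinct ones meeting at most in a common endpoint, $N$ (the nodes) is the set of endpoints of the bonds, and there is a basis $\underline{a}=(a_1,a_2,a_3)$ of $\mathbb{R}^3$ (a periodicity basis) such that $N$ and $S$ are invariant under the translation group $\mathcal{T}(\underline{a})=\mathbb{Z}a_1+\mathbb{Z}a_2+\mathbb{Z}a_3$ and consist of finitely many $\mathcal{T}(\underline a)$-orbits. A periodicity basis is primitive if its translation group is not properly contained in that of another periodicity basis. The labelled quotient graph of $(\mathcal{N},\underline{a})$ has as vertices a set of representatives $v$ of the $\mathcal{T}(\underline{a})$-orbits of nodes and, for each orbit of bonds, represented by $[v+\sum_i k_ia_i,\,w+\sum_i l_ia_i]$ with $v,w$ representatives, a directed edge from $v$ to $w$ with label $k-l\in\mathbb{Z}^3$ (identified with the edge from $w$ to $v$ with label $l-k$). Its depth is the maximum modulus of the coordinates of the labels, and the adjacency depth of $\mathcal{N}$ is the minimum of these depths over the primitive periodicity bases (and choices of representatives). A lattice net is a proper linear 3-periodic net whose quotient graph with respect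 to a primitive periodicity basis has a single vertex. A net is connected if its structure graph (vertices $N$, adjacency given by bonds) is connected. Two nets $\mathcal{N}_1,\mathcal{N}_2$ are orientedly affinely equivalent if some translates of them correspond under a real $3\times 3$ matrix of positive determinant. **Theorem.** The lattice nets of adjacency depth 1 are exactly the proper linear 3-periodic nets that have a periodicity basis whose labelled quotient graph has a single vertex and depth 1. There are exactly 19 oriented affine equivalence classes of connected lattice nets of adjacency depth 1. Each class contains exactly one of the following 19 model nets, all of which are connected lattice nets of adjacency depth 1. With $a_x=(1,0,0)$, $a_y=(0,1,0)$, $a_z=(0,0,1)$, $f_x=(0,1,1)$, $f_y=(1,0,1)$, $f_z=(1,1,0)$, $g_x=(0,1,-1)$, $g_y=(1,0,-1)$, $g_z=(1,-1,0)$, $d_1=(1,1,1)$, the model net of a word $w$ in these letters has node set $\mathbb{Z}^3$ and bonds $[p,p+e]$ for all $p\in\mathbb{Z}^3$ and all letters $e$ of $w$, and the 19 words are $a_xa_ya_z$; $a_xa_ya_zd_1$; $a_xa_ya_zf_x$; $a_xa_yg_xd_1$; $a_xg_xg_yd_1$; $a_xg_yg_zd_1$; $a_xa_ya_zf_xf_y$;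 $a_xa_ya_zg_xd_1$; $a_xa_yg_xg_yd_1$; $a_xa_yg_xg_zd_1$; $a_xg_xg_yg_zd_1$; $a_xa_ya_zf_xf_yf_z$; $a_xa_ya_zg_xg_yg_z$; $a_xa_ya_zg_xg_yd_1$; $a_xa_yg_xg_yf_zd_1$; $a_xa_yg_xg_yg_zd_1$; $a_xa_ya_zf_xf_yf_zd_1$; $a_xa_ya_zg_xg_yf_zd_1$; $a_xa_ya_zg_xg_yg_zd_1$. -/

import Mathlib

/-- Ambient space `ℝ³` (only its affine structure is used). -/
abbrev Space : Type := Fin 3 → ℝ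

/-- A bond-node structure `(N, S)` in `ℝ³`: a set of nodes and a set of straight bonds.
A bond `[p, q]` is recorded by its unordered pair of endpoints `s(p, q)`; the segment itself is
`segment ℝ p q`, and (for `p ≠ q`) pair and segment determine each other. -/
@[ext]
structure Net where
  nodes : Set Space
  edges : Set (Sym2 Space)

/-- The translation group `{k₁ a₁ + k₂ a₂ + k₃ a₃ : k ∈ ℤ³}` of a basis of `ℝ³`. -/
def translationGroup (a : Module.Basis (Fin 3) ℝ Space) : Submodule ℤ Space :=
  Submodule.span ℤ (Set.range a)

namespace Net

/-- The translates of the basis `a` preserve the set of nodes and the set of bonds. -/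
structure IsPeriodicityBasis (M : Net) (a : Module.Basis (Fin 3) ℝ Space) : Prop where
  nodes_invariant : ∀ t ∈ translationGroup a, ∀ x ∈ M.nodes, t + x ∈ M.nodes
  edges_invariant : ∀ t ∈ translationGroup a, ∀ e ∈ M.edges, e.map (fun x => t + x) ∈ M.edges

/-- Proper linear 3-periodic nets in `ℝ³`. -/
structure IsProperLinearPeriodic (M : Net) : Prop where
  countable_edges : M.edges.Countable
  /-- bonds are nondegenerate -/
  not_isDiag : ∀ e ∈ M.edges, ¬ e.IsDiag
  /-- distinct bonds are essentially disjoint: they meet at most in a common endpoint -/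
  essentially_disjoint : ∀ p q p' q' : Space, s(p, q) ∈ M.edges → s(p', q') ∈ M.edges →
    s(p, q) ≠ s(p', q') →
    segment ℝ p q ∩ segment ℝ p' q' ⊆ {x | x ∈ s(p, q) ∧ x ∈ s(p', q')}
  /-- the nodes are exactly the endpoints of the bonds -/
  nodes_eq : M.nodes = {x | ∃ e ∈ M.edges, x ∈ e}
  /-- there is a periodicity basis with finitely many translation classes of nodes and bonds -/
  periodic : ∃ a : Module.Basis (Fin 3) ℝ Space, M.IsPeriodicityBasis a ∧
    (∃ Fv : Set Space, Fv.Finite ∧ Fv ⊆ M.nodes ∧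
      ∀ x ∈ M.nodes, ∃ v ∈ Fv, ∃ t ∈ translationGroup a, x = t + v) ∧
    (∃ Fe : Set (Sym2 Space), Fe.Finite ∧ Fe ⊆ M.edges ∧
      ∀ e ∈ M.edges, ∃ f ∈ Fe, ∃ t ∈ translationGroup a, e = f.map (fun x => t + x))

/-- The structure graph of a net: vertices are the nodes, adjacency is being joined by a bond. -/
def structureGraph (M : Net) : SimpleGraph M.nodes :=
  (SimpleGraph.fromEdgeSet M.edges).induce M.nodes

/-- A primitive (maximal) periodicity basis: no periodicity basis has a strictly larger
translation group. -/
def IsPrimitiveBasis (M : Net) (a : Module.Basis (Fin 3) ℝ Space) : Prop :=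
  M.IsPeriodicityBasis a ∧
    ∀ b : Module.Basis (Fin 3) ℝ Space, M.IsPeriodicityBasis b →
      ¬ translationGroup a < translationGroup b

/-- `F` is a set of representatives for the translation classes of the nodes, with respect
to `a`. These are the vertices of the labelled quotient graph. -/
def IsNodeMotif (M : Net) (a : Module.Basis (Fin 3) ℝ Space) (F : Set Space) : Prop :=
  F ⊆ M.nodes ∧ ∀ x ∈ M.nodes, ∃! v : Space, v ∈ F ∧ x - v ∈ translationGroup a

/-- The directed labelled edges of the labelled quotient graph of `(M, a)` with vertex set the node
motif `F`: `(v, w, k)` is an edge from `v` to `w` with label `k ∈ ℤ³` when the translate by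
`∑ kᵢ aᵢ` of `v` is joined to `w` by a bond. Every translation class of bonds gives one edge,
listed with both of its directions, `(v, w, k)` and `(w, v, -k)`. -/
def lqgEdges (M : Net) (a : Module.Basis (Fin 3) ℝ Space) (F : Set Space) :
    Set (Space × Space × (Fin 3 → ℤ)) :=
  {e | e.1 ∈ F ∧ e.2.1 ∈ F ∧ s((∑ i, e.2.2 i • a i) + e.1, e.2.1) ∈ M.edges}

/-- The depth of the labelled quotient graph: the maximum modulus of the coordinates of the
edge labels. -/
noncomputable def lqgDepth (M : Net) (a : Module.Basis (Fin 3) ℝ Space) (F : Set Space) : ℕ∞ :=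
  ⨆ e ∈ M.lqgEdges a F, ⨆ i : Fin 3, ((e.2.2 i).natAbs : ℕ∞)

/-- The adjacency depth of a net: the minimal depth of a labelled quotient graph over all primitive
periodicity bases (and over the node motifs; when there is one translation class of nodes, the
labels do not depend on the motif). -/
noncomputable def adjacencyDepth (M : Net) : ℕ∞ :=
  ⨅ (a : Module.Basis (Fin 3) ℝ Space) (_ : M.IsPrimitiveBasis a)
    (F : Set Space) (_ : M.IsNodeMotif a F), M.lqgDepth a F

/-- A lattice net: a proper linear 3-periodic net whose quotient graph (the one of a primitive
periodicity basis) has a single vertex. -/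
def IsLatticeNet (M : Net) : Prop :=
  M.IsProperLinearPeriodic ∧
    ∃ a : Module.Basis (Fin 3) ℝ Space, M.IsPrimitiveBasis a ∧
      ∃ v : Space, M.IsNodeMotif a {v}

/-- Proper linear 3-periodic nets having some periodicity basis whose labelled quotient graph has a
single vertex and depth 1. -/
def HasSingleVertexDepthOneLQG (M : Net) : Prop :=
  M.IsProperLinearPeriodic ∧
    ∃ a : Module.Basis (Fin 3) ℝ Space, M.IsPeriodicityBasis a ∧
      ∃ v : Space, M.IsNodeMotif a {v} ∧ M.lqgDepth a {v} = 1

/-- Connected lattice nets of adjacency depth 1. -/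
def IsConnectedDepthOneLatticeNet (M : Net) : Prop :=
  M.IsLatticeNet ∧ M.structureGraph.Connected ∧ M.adjacencyDepth = 1

/-- The image of a net under a map of the ambient space, moving nodes and bond endpoints. -/
def map (f : Space → Space) (M : Net) : Net where
  nodes := f '' M.nodes
  edges := Sym2.map f '' M.edges

/-- The translate of a net by a vector. -/
def translate (t : Space) (M : Net) : Net := M.map (fun x => x + t)

/-- Oriented affine equivalence: some translates of the two nets correspond under a real matrix of
positive determinant. -/
def OrientedAffineEquiv (M₁ M₂ : Net) : Prop :=
  ∃ X : Matrix (Fin 3) (Fin 3) ℝ, 0 < X.det ∧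
    ∃ s t : Space, (M₁.translate s).map X.mulVec = M₂.translate t

theorem map_map (f g : Space → Space) (M : Net) : (M.map f).map g = M.map (g ∘ f) := by
  ext x
  · simp [map]
  · simp [map, Sym2.map_map]

theorem map_id' (f : Space → Space) (hf : ∀ x, f x = x) (M : Net) : M.map f = M := by
  have : f = id := funext hf
  subst this
  ext x <;> simp [map]

theorem orientedAffineEquiv_iff (M₁ M₂ : Net) : M₁.OrientedAffineEquiv M₂ ↔
    ∃ X : Matrix (Fin 3) (Fin 3) ℝ, 0 < X.det ∧
      ∃ u : Space, M₁.map (fun x => X.mulVec x + u) = M₂ := by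
  constructor
  · rintro ⟨X, hX, s, t, h⟩
    refine ⟨X, hX, X.mulVec s - t, ?_⟩
    have h2 := congrArg (Net.map (fun x => x - t)) h
    simp only [translate, map_map] at h2
    rw [map_id' ((fun x => x - t) ∘ fun x => x + t) (by intro x; simp) M₂] at h2
    rw [← h2]
    congr 1
    funext x
    simp only [Function.comp, Matrix.mulVec_add]
    abel
  · rintro ⟨X, hX, u, h⟩
    refine ⟨X, hX, 0, -u, ?_⟩
    rw [← h]
    simp only [translate, map_map]
    congr 1
    funext x
    simp [Function.comp]

/-- Oriented affine equivalence is an equivalence relation. -/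
def orientedAffineSetoid : Setoid Net where
  r := OrientedAffineEquiv
  iseqv := by
    refine ⟨fun M => ?_, fun {M₁ M₂} h => ?_, fun {M₁ M₂ M₃} h h' => ?_⟩
    · rw [orientedAffineEquiv_iff]
      exact ⟨1, by simp, 0, map_id' _ (by intro x; simp) M⟩
    · rw [orientedAffineEquiv_iff] at h ⊢
      obtain ⟨X, hX, u, rfl⟩ := h
      have hu : IsUnit X.det := isUnit_iff_ne_zero.mpr hX.ne'
      refine ⟨X⁻¹, ?_, -(X⁻¹.mulVec u), ?_⟩
      · rw [Matrix.det_nonsing_inv, Ring.inverse_eq_inv']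
        exact inv_pos.mpr hX
      · rw [map_map]
        refine map_id' _ (fun x => ?_) M₁
        simp [Matrix.mulVec_add, Matrix.mulVec_mulVec, Matrix.nonsing_inv_mul _ hu]
    · rw [orientedAffineEquiv_iff] at h h' ⊢
      obtain ⟨X, hX, u, rfl⟩ := h
      obtain ⟨Y, hY, w, rfl⟩ := h'
      refine ⟨Y * X, by rw [Matrix.det_mul]; exact mul_pos hY hX, Y.mulVec u + w, ?_⟩
      rw [map_map]
      congr 1
      funext x
      simp [Function.comp, Matrix.mulVec_add, Matrix.mulVec_mulVec, add_assoc]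

end Net

/-- The letters of the defining edge words: axial edges `a`, face diagonals `f` and `g`, and the
cube diagonal `d₁`, each given by its edge vector in `ℤ³`. -/
inductive EdgeLetter where
  | ax | ay | az | fx | fy | fz | gx | gy | gz | d1

/-- The edge vector of a letter. -/
def EdgeLetter.vec : EdgeLetter → (Fin 3 → ℤ)
  | .ax => ![1, 0, 0]
  | .ay => ![0, 1, 0]
  | .az => ![0, 0, 1]
  | .fx => ![0, 1, 1]
  | .fy => ![1, 0, 1]
  | .fz => ![1, 1, 0]
  | .gx => ![0, 1, -1]
  | .gy => ![1, 0, -1]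
  | .gz => ![1, -1, 0]
  | .d1 => ![1, 1, 1]

/-- The point of `ℝ³` with the given integer coordinates. -/
def intPoint (k : Fin 3 → ℤ) : Space := fun i => (k i : ℝ)

/-- The model net of an edge word: the nodes are the points of `ℤ³`, the bonds are all the integer
translates of the edges in the word. -/
def wordNet (w : List EdgeLetter) : Net where
  nodes := Set.range intPoint
  edges := {e | ∃ l ∈ w, ∃ k : Fin 3 → ℤ, e = s(intPoint k, intPoint (k + l.vec))}

open EdgeLetter in
/-- The defining edge words of the 19 model nets. -/
def modelWord : Fin 19 → List EdgeLetter :=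
  ![[ax, ay, az],
    [ax, ay, az, d1],
    [ax, ay, az, fx],
    [ax, ay, gx, d1],
    [ax, gx, gy, d1],
    [ax, gy, gz, d1],
    [ax, ay, az, fx, fy],
    [ax, ay, az, gx, d1],
    [ax, ay, gx, gy, d1],
    [ax, ay, gx, gz, d1],
    [ax, gx, gy, gz, d1],
    [ax, ay, az, fx, fy, fz],
    [ax, ay, az, gx, gy, gz],
    [ax, ay, az, gx, gy, d1],
    [ax, ay, gx, gy, fz, d1],
    [ax, ay, gx, gy, gz, d1],
    [ax, ay, az, fx, fy, fz, d1],
    [ax, ay, az, gx, gy, fz, d1],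
    [ax, ay, az, gx, gy, gz, d1]]

/-- The 19 model nets. -/
def modelNet (i : Fin 19) : Net := wordNet (modelWord i)

/-! In the coordinates of a depth-one periodicity basis, with a node as origin, the nodes become
`ℤ³` and the bonds are determined by the finite symmetric set `E` of edge vectors at one node. Depth
1 puts `E` in `{-1, 0, 1}³`, and connectedness says that `E` generates `ℤ³`. Properness says that
vectors of `E` congruent mod 2 agree up to sign. Indeed, if `u ≡ w` but `u ≠ ±w`, then the bonds
`[0, u]` and `[c, c + w]` with `c = (u - w) / 2` share their midpoint. If `u` and `w` are
incongruent, some 2×2 minor of the pair is odd, hence `±1`, and Cramer's rule makes the parameters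
of any crossing integers. So these nets are the affine images of the lattice nets of stars
(`IsStar`, `IsConnectedDepthOneLatticeNet.exists_isStar`, `IsStar.isConnectedDepthOneLatticeNet`).

Affine equivalences between lattice nets of stars come from matrices of `GL(3, ℤ)` carrying one star
to the other. Orientation costs nothing, because `-1` fixes every star and has determinant `-1`.
What remains is to count the `GL(3, ℤ)`-orbits of stars. A descent on a weight, whose steps are
checked over all finitely many candidates, brings each star to a model (`IsStar.exists_model`). The
sum of `det⁴` over all triples of edge vectors is an invariant with 19 distinct values on the models
(`detPowerSum_injective`).

The description by single-vertex quotient graphs holds because, with one class of nodes, the periods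
are exactly the differences of nodes: such a basis is primitive, and all primitive bases have the
same translation group. -/

/-! ### Finite data and the computer-checked reduction -/

/-- The determinant of three integer vectors. -/
def det3 (u v w : Fin 3 → ℤ) : ℤ :=
  u 0 * (v 1 * w 2 - v 2 * w 1) - u 1 * (v 0 * w 2 - v 2 * w 0) + u 2 * (v 0 * w 1 - v 1 * w 0)

/-- The action of an integer matrix on an integer vector, in a form that evaluates quickly. -/
def act (P : Matrix (Fin 3) (Fin 3) ℤ) (v : Fin 3 → ℤ) : Fin 3 → ℤ :=
  ![P 0 0 * v 0 + P 0 1 * v 1 + P 0 2 * v 2,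
    P 1 0 * v 0 + P 1 1 * v 1 + P 1 2 * v 2,
    P 2 0 * v 0 + P 2 1 * v 1 + P 2 2 * v 2]

/-- A linear form that is injective on `{-1, 0, 1}³`; its sign selects one vector of each pair `±v`
and its absolute value numbers the pairs from 1 to 13. -/
def code (v : Fin 3 → ℤ) : ℤ := 9 * v 0 + 3 * v 1 + v 2

/-- The vectors of `{-1, 0, 1}³` with positive code. -/
def posVectors : List (Fin 3 → ℤ) :=
  [![0, 0, 1], ![0, 1, -1], ![0, 1, 0], ![0, 1, 1], ![1, -1, -1], ![1, -1, 0], ![1, -1, 1],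
    ![1, 0, -1], ![1, 0, 0], ![1, 0, 1], ![1, 1, -1], ![1, 1, 0], ![1, 1, 1]]

/-- Matrices in `GL(3, ℤ)` that suffice to reduce every edge star to a model one. -/
def reducers : List (Matrix (Fin 3) (Fin 3) ℤ) :=
  [!![0, 1, 0; 1, 0, 0; 0, 0, 1], !![1, 0, 0; 0, 0, 1; 0, 1, 0],
    !![-1, 0, 0; 0, 1, 0; 0, 0, 1], !![1, 0, 0; 0, -1, 0; 0, 0, 1],
    !![-1, 1, 0; 0, 1, 0; 0, 0, 1], !![-1, 0, 1; 0, 1, 0; 0, 0, 1],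
    !![1, 0, 0; 1, -1, 0; 0, 0, 1], !![1, 0, 0; 0, -1, 1; 0, 0, 1],
    !![1, 0, 0; 0, 1, 0; 1, 0, -1], !![1, 0, 0; 0, 1, 0; 0, 1, -1],
    !![0, 1, -1; -1, 0, 1; 1, 0, 0]]

/-- A weight on vectors of `{-1, 0, 1}³` that the matrices in `reducers` can lower. -/
def weight (v : Fin 3 → ℤ) : ℕ :=
  -- Entry `n` belongs to the pair `±v` with `|code v| = n`; entry 0 is the zero vector. The default
  -- is never reached inside the cube. The values matter only through `oddSublists_reduce`.
  [0, 56, 108, 25, 91, 193, 117, 151, 115, 21, 92, 287, 101, 106].getD (code v).natAbs 0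

/-- The edge vectors of a model net. -/
def modelVectors (i : Fin 19) : List (Fin 3 → ℤ) := (modelWord i).map EdgeLetter.vec

/-- Incongruence modulo 2. -/
def oddDiff (u v : Fin 3 → ℤ) : Bool :=
  !((u 0 - v 0) % 2 == 0 && (u 1 - v 1) % 2 == 0 && (u 2 - v 2) % 2 == 0)

/-- The sublists of a list whose members are pairwise incongruent modulo 2. -/
def oddSublists : List (Fin 3 → ℤ) → List (List (Fin 3 → ℤ))
  | [] => [[]]
  | v :: L => oddSublists L ++ ((oddSublists L).filter fun l => l.all (oddDiff v)).map (v :: ·)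

/-- All coordinates are in `{-1, 0, 1}`. -/
def inUnitCube (v : Fin 3 → ℤ) : Bool :=
  (v 0).natAbs ≤ 1 && (v 1).natAbs ≤ 1 && (v 2).natAbs ≤ 1

/-- Equality of vectors up to sign. -/
def eqUpToSign (u v : Fin 3 → ℤ) : Bool :=
  (u 0 == v 0 && u 1 == v 1 && u 2 == v 2) || (u 0 == -v 0 && u 1 == -v 1 && u 2 == -v 2)

/-- Two lists of vectors have the same members up to sign. -/
def sameUpToSign (L L' : List (Fin 3 → ℤ)) : Bool :=
  L.all (fun u => L'.any (eqUpToSign u)) && L'.all (fun u => L.any (eqUpToSign u))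

/-- The matrix keeps the vectors in `{-1, 0, 1}³` and lowers their total weight. -/
def lowersWeight (L : List (Fin 3 → ℤ)) (P : Matrix (Fin 3) (Fin 3) ℤ) : Bool :=
  (L.all fun v => inUnitCube (act P v)) &&
    (L.map fun v => weight (act P v)).sum < (L.map weight).sum

/-- The matrix carries the vectors to those of some model net, up to sign. -/
def reachesModel (L : List (Fin 3 → ℤ)) (P : Matrix (Fin 3) (Fin 3) ℤ) : Bool :=
  (List.finRange 19).any fun i => sameUpToSign (L.map (act P)) (modelVectors i)

/-- All vectors of `L` are orthogonal to `n` modulo `p`. -/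
def annihilatedMod (p : ℤ) (L : List (Fin 3 → ℤ)) (n : Fin 3 → ℤ) : Bool :=
  L.all fun v => (n 0 * v 0 + n 1 * v 1 + n 2 * v 2) % p == 0

/-- The vectors of `L` lie in a proper sublattice of `ℤ³` of index 2 or 3. -/
def nonSpanning (L : List (Fin 3 → ℤ)) : Bool :=
  -- Up to sign, `posVectors` represents every nonzero linear form mod 2 and mod 3. Other primes are
  -- not needed: a determinant with entries in `{-1, 0, 1}` has modulus at most 4.
  posVectors.any fun n => annihilatedMod 2 L n || annihilatedMod 3 L n

/-- Every list of pairwise incongruent vectors with positive code is nonspanning, or some reducer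
lowers its weight, or it is at most one reducer away from a model net. -/
theorem oddSublists_reduce : (oddSublists posVectors).all (fun L =>
    reducers.any (lowersWeight L) || (1 :: reducers).any (reachesModel L) || nonSpanning L) := by
  -- There are `2³ · 3³ · 5 = 1080` lists: the seven nonzero classes mod 2 contain 1, 1, 1, 2, 2, 2
  -- and 4 of the 13 vectors, and a list takes at most one from each.
  decide +kernel

/-- The sum of the fourth powers of the determinants of all triples of members of a list. -/
def detPowerSum (L : List (Fin 3 → ℤ)) : ℤ :=
  (L.map fun u => (L.map fun v => (L.map fun w => det3 u v w ^ 4).sum).sum).sum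

theorem detPowerSum_modelVectors : (List.finRange 19).map (fun i => detPowerSum (modelVectors i)) =
    [6, 24, 18, 114, 594, 504, 48, 144, 720, 624, 1584, 192, 96, 768, 864, 1728, 264, 936, 1896] := by
  decide +kernel

theorem detPowerSum_injective :
    Function.Injective fun i : Fin 19 => detPowerSum (modelVectors i) := by
  have h : ((List.finRange 19).map fun i => detPowerSum (modelVectors i)).Nodup := by
    rw [detPowerSum_modelVectors]; decide
  intro i j hij
  exact List.inj_on_of_nodup_map h (List.mem_finRange i) (List.mem_finRange j) hij

/-! ### Integer matrices acting on vectors up to sign -/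

open Matrix in
theorem act_eq_mulVec (P : Matrix (Fin 3) (Fin 3) ℤ) (v : Fin 3 → ℤ) : act P v = P *ᵥ v := by
  ext i
  fin_cases i <;> simp [act, Matrix.mulVec, dotProduct, Fin.sum_univ_three]

theorem det3_act (P : Matrix (Fin 3) (Fin 3) ℤ) (u v w : Fin 3 → ℤ) :
    det3 (act P u) (act P v) (act P w) = P.det * det3 u v w := by
  simp only [det3, act, Matrix.det_fin_three, Matrix.cons_val]
  ring

theorem act_neg (P : Matrix (Fin 3) (Fin 3) ℤ) (v : Fin 3 → ℤ) : act P (-v) = -act P v := by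
  simp [act_eq_mulVec, Matrix.mulVec_neg]

theorem act_mul (P Q : Matrix (Fin 3) (Fin 3) ℤ) (v : Fin 3 → ℤ) :
    act (P * Q) v = act P (act Q v) := by
  simp [act_eq_mulVec]

theorem act_one (v : Fin 3 → ℤ) : act 1 v = v := by simp [act_eq_mulVec]

theorem act_injective {P : Matrix (Fin 3) (Fin 3) ℤ} (hP : IsUnit P.det) :
    Function.Injective (act P) := by
  intro u v h
  have := congrArg (act P⁻¹) h
  simpa [← act_mul, Matrix.nonsing_inv_mul _ hP, act_one] using this

theorem code_neg (v : Fin 3 → ℤ) : code (-v) = -code v := by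
  simp only [code, Pi.neg_apply]; ring

theorem weight_neg (v : Fin 3 → ℤ) : weight (-v) = weight v := by
  simp [weight, code_neg]

/-- The finite set of all vectors of a list and their negatives. -/
def symmetrize (L : List (Fin 3 → ℤ)) : Finset (Fin 3 → ℤ) :=
  L.toFinset ∪ (L.map fun v => -v).toFinset

theorem mem_symmetrize {L : List (Fin 3 → ℤ)} {v : Fin 3 → ℤ} :
    v ∈ symmetrize L ↔ v ∈ L ∨ -v ∈ L := by
  simp [symmetrize, neg_eq_iff_eq_neg]

/-- Positive codes keep `L` and `-L` disjoint, so each pair `±v` contributes twice. -/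
theorem sum_symmetrize {R : Type*} [AddCommMonoid R] {L : List (Fin 3 → ℤ)} (hL : L.Nodup)
    (hpos : ∀ v ∈ L, 0 < code v) (f : (Fin 3 → ℤ) → R) (hf : ∀ v, f (-v) = f v) :
    ∑ v ∈ symmetrize L, f v = 2 • (L.map f).sum := by
  rw [symmetrize, Finset.sum_union, List.sum_toFinset f hL, List.sum_toFinset f
    (hL.map neg_injective), List.map_map, two_nsmul]
  · simp only [Function.comp_def, hf]
  · rw [Finset.disjoint_left]
    intro v hv hv'
    simp only [List.mem_toFinset, List.mem_map] at hv hv'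
    obtain ⟨u, hu, rfl⟩ := hv'
    have h1 := hpos _ hu
    have h2 := hpos _ hv
    rw [code_neg] at h2
    omega

theorem posVectors_nodup : posVectors.Nodup := by decide

theorem code_pos_of_mem_posVectors : ∀ v ∈ posVectors, 0 < code v := by decide

theorem abs_le_of_mem_posVectors : ∀ v ∈ posVectors, ∀ i, |v i| ≤ 1 := by decide

theorem mem_posVectors_or_neg {v : Fin 3 → ℤ} (h : ∀ i, |v i| ≤ 1) (h0 : v ≠ 0) :
    v ∈ posVectors ∨ -v ∈ posVectors := by
  have key : ∀ a ∈ Finset.Icc (-1 : ℤ) 1, ∀ b ∈ Finset.Icc (-1 : ℤ) 1,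
      ∀ c ∈ Finset.Icc (-1 : ℤ) 1, ![a, b, c] ≠ 0 →
        ![a, b, c] ∈ posVectors ∨ -![a, b, c] ∈ posVectors := by decide +kernel
  have hv : v = ![v 0, v 1, v 2] := by ext i; fin_cases i <;> rfl
  rw [hv] at h0 ⊢
  have hm : ∀ i, v i ∈ Finset.Icc (-1 : ℤ) 1 := fun i => Finset.mem_Icc.2 (abs_le.1 (h i))
  exact key _ (hm 0) _ (hm 1) _ (hm 2) h0

/-! ### Stars and their reduction to the models -/

/-- The conditions on the set of edge vectors at a node of a connected depth one lattice net. -/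
structure IsStar (E : Finset (Fin 3 → ℤ)) : Prop where
  neg_mem : ∀ v ∈ E, -v ∈ E
  abs_coord_le : ∀ v ∈ E, ∀ i, |v i| ≤ 1
  ne_zero : ∀ v ∈ E, v ≠ 0
  eq_or_eq_neg : ∀ u ∈ E, ∀ v ∈ E, (∀ i, (2 : ℤ) ∣ u i - v i) → u = v ∨ u = -v
  closure_eq_top : AddSubgroup.closure (E : Set (Fin 3 → ℤ)) = ⊤

/-- The members of a finite set with positive code. -/
def halfStar (E : Finset (Fin 3 → ℤ)) : List (Fin 3 → ℤ) := posVectors.filter (· ∈ E)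

theorem halfStar_nodup (E : Finset (Fin 3 → ℤ)) : (halfStar E).Nodup := posVectors_nodup.filter _

theorem code_pos_of_mem_halfStar {E : Finset (Fin 3 → ℤ)} {v : Fin 3 → ℤ} (h : v ∈ halfStar E) :
    0 < code v := code_pos_of_mem_posVectors _ (List.mem_filter.1 h).1

theorem mem_of_mem_halfStar {E : Finset (Fin 3 → ℤ)} {v : Fin 3 → ℤ} (h : v ∈ halfStar E) :
    v ∈ E := by simpa using (List.mem_filter.1 h).2

namespace IsStar

variable {E : Finset (Fin 3 → ℤ)}

theorem symmetrize_halfStar (hE : IsStar E) : symmetrize (halfStar E) = E := by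
  ext v
  rw [mem_symmetrize]
  constructor
  · rintro (h | h)
    · exact mem_of_mem_halfStar h
    · simpa using hE.neg_mem _ (mem_of_mem_halfStar h)
  · intro h
    have := mem_posVectors_or_neg (hE.abs_coord_le v h) (hE.ne_zero v h)
    simpa [halfStar, h, hE.neg_mem v h] using this

/-- Two distinct vectors of positive code are never opposite, so in a star they must be incongruent
mod 2. -/
theorem halfStar_mem_oddSublists (hE : IsStar E) : halfStar E ∈ oddSublists posVectors := by
  have key : ∀ {l L : List (Fin 3 → ℤ)}, l.Sublist L → l.Pairwise (fun u v => oddDiff u v) →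
      l ∈ oddSublists L := by
    intro l L h
    induction h with
    | slnil => simp [oddSublists]
    | cons v _ ih => intro hp; simp [oddSublists, ih hp]
    | cons_cons v _ ih =>
      intro hp
      rw [List.pairwise_cons] at hp
      simp [oddSublists, ih hp.2]
      exact Or.inr hp.1
  refine key List.filter_sublist ?_
  refine List.Pairwise.imp_of_mem ?_ (halfStar_nodup E)
  intro u v hu hv huv
  by_contra hodd
  have h : ∀ i, (2 : ℤ) ∣ u i - v i := by
    simp only [oddDiff, Bool.not_eq_true', Bool.and_eq_false_iff, beq_eq_false_iff_ne] at hodd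
    push Not at hodd
    intro i
    fin_cases i
    · exact Int.dvd_of_emod_eq_zero hodd.1.1
    · exact Int.dvd_of_emod_eq_zero hodd.1.2
    · exact Int.dvd_of_emod_eq_zero hodd.2
  rcases hE.eq_or_eq_neg u (mem_of_mem_halfStar hu) v (mem_of_mem_halfStar hv) h with h | h
  · exact huv h
  · have h1 := code_pos_of_mem_halfStar hu
    have h2 := code_pos_of_mem_halfStar hv
    rw [h, code_neg] at h1
    omega

/-- Unimodular matrices preserve every condition on a star except the coordinate bound, which is
therefore a hypothesis. -/
theorem image (hE : IsStar E) {P : Matrix (Fin 3) (Fin 3) ℤ} (hP : IsUnit P.det)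
    (hr : ∀ v ∈ E, ∀ i, |act P v i| ≤ 1) : IsStar (E.image (act P)) where
  neg_mem := by
    intro v hv
    obtain ⟨u, hu, rfl⟩ := Finset.mem_image.1 hv
    exact Finset.mem_image.2 ⟨-u, hE.neg_mem u hu, act_neg P u⟩
  abs_coord_le := by
    intro v hv
    obtain ⟨u, hu, rfl⟩ := Finset.mem_image.1 hv
    exact hr u hu
  ne_zero := by
    intro v hv h0
    obtain ⟨u, hu, rfl⟩ := Finset.mem_image.1 hv
    refine hE.ne_zero u hu (act_injective hP ?_)
    rw [h0, act_eq_mulVec, Matrix.mulVec_zero]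
  eq_or_eq_neg := by
    intro u' hu v' hv h
    obtain ⟨u, hu', rfl⟩ := Finset.mem_image.1 hu
    obtain ⟨v, hv', rfl⟩ := Finset.mem_image.1 hv
    have hd : ∀ i, (2 : ℤ) ∣ u i - v i := by
      intro i
      -- The inverse of `P` is integral, so congruence mod 2 pulls back along `P`.
      have h1 : u - v = act P⁻¹ (act P u - act P v) := by
        simp only [act_eq_mulVec, ← Matrix.mulVec_sub, Matrix.mulVec_mulVec,
          Matrix.nonsing_inv_mul _ hP, Matrix.one_mulVec]
      have h2 := congrFun h1 i
      rw [Pi.sub_apply, act_eq_mulVec, Matrix.mulVec, dotProduct] at h2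
      rw [h2]
      exact Finset.dvd_sum fun j _ => Dvd.dvd.mul_left (h j) _
    rcases hE.eq_or_eq_neg u hu' v hv' hd with rfl | rfl
    · exact Or.inl rfl
    · exact Or.inr (act_neg P v)
  closure_eq_top := by
    have hs : Function.Surjective P.mulVecLin.toAddMonoidHom := by
      intro v
      refine ⟨P⁻¹.mulVec v, ?_⟩
      simp [Matrix.mulVec_mulVec, Matrix.mul_nonsing_inv _ hP]
    have h1 := AddMonoidHom.map_closure P.mulVecLin.toAddMonoidHom (E : Set (Fin 3 → ℤ))
    rw [hE.closure_eq_top, AddSubgroup.map_top_of_surjective _ hs] at h1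
    rw [h1, Finset.coe_image]
    congr 1
    refine Set.image_congr fun v _ => ?_
    simp [act_eq_mulVec]

theorem sum_eq (hE : IsStar E) {R : Type*} [AddCommMonoid R] (f : (Fin 3 → ℤ) → R)
    (hf : ∀ v, f (-v) = f v) : ∑ v ∈ E, f v = 2 • ((halfStar E).map f).sum := by
  conv_lhs => rw [← hE.symmetrize_halfStar]
  exact sum_symmetrize (halfStar_nodup E) (fun v hv => code_pos_of_mem_halfStar hv) f hf

/-- A form vanishing mod `p` on generators vanishes mod `p` on `ℤ³`. Evaluating at the unit vectors
gives `p ∣ n`, impossible for a nonzero `n` with coordinates in `{-1, 0, 1}`. -/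
theorem not_nonSpanning (hE : IsStar E) : ¬ nonSpanning (halfStar E) := by
  intro h
  have key : ∀ p : ℤ, ∀ n : Fin 3 → ℤ, annihilatedMod p (halfStar E) n → ∀ i, p ∣ n i := by
    intro p n hn
    have hx : ∀ x : Fin 3 → ℤ, p ∣ n 0 * x 0 + n 1 * x 1 + n 2 * x 2 := by
      intro x
      have hx : x ∈ AddSubgroup.closure (E : Set (Fin 3 → ℤ)) := by
        rw [hE.closure_eq_top]; trivial
      induction hx using AddSubgroup.closure_induction with
      | mem x hx =>
        rw [← hE.symmetrize_halfStar, Finset.mem_coe, mem_symmetrize] at hx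
        simp only [annihilatedMod, List.all_eq_true, beq_iff_eq] at hn
        rcases hx with hx | hx
        · exact Int.dvd_of_emod_eq_zero (hn x hx)
        · have := Int.dvd_of_emod_eq_zero (hn _ hx)
          simp only [Pi.neg_apply, mul_neg, ← neg_add] at this
          exact (dvd_neg.1 this)
      | zero => simp
      | add x y _ _ hx hy =>
        have h := dvd_add hx hy
        simp only [Pi.add_apply]
        ring_nf at h ⊢
        exact h
      | neg x _ hx =>
        simp only [Pi.neg_apply, mul_neg, ← neg_add]
        exact dvd_neg.2 hx
    intro i
    fin_cases i
    · simpa using hx ![1, 0, 0]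
    · simpa using hx ![0, 1, 0]
    · simpa using hx ![0, 0, 1]
  have h2 : ∀ n ∈ posVectors, ¬ ∀ i, (2 : ℤ) ∣ n i := by decide
  have h3 : ∀ n ∈ posVectors, ¬ ∀ i, (3 : ℤ) ∣ n i := by decide
  simp only [nonSpanning, List.any_eq_true, Bool.or_eq_true] at h
  obtain ⟨n, hn, h | h⟩ := h
  · exact h2 n hn (key 2 n h)
  · exact h3 n hn (key 3 n h)

end IsStar

theorem isUnit_det_of_mem_reducers : ∀ P ∈ (1 :: reducers), IsUnit P.det := by
  simp only [Int.isUnit_iff, reducers, List.forall_mem_cons]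
  simp [Matrix.det_fin_three]

theorem inUnitCube_iff {v : Fin 3 → ℤ} : inUnitCube v ↔ ∀ i, |v i| ≤ 1 := by
  have e : ∀ i, |v i| ≤ 1 ↔ (v i).natAbs ≤ 1 := fun i => by rw [Int.abs_eq_natAbs]; omega
  simp only [inUnitCube, Bool.and_eq_true, decide_eq_true_eq, e]
  refine ⟨fun h i => ?_, fun h => ⟨⟨h 0, h 1⟩, h 2⟩⟩
  fin_cases i
  exacts [h.1.1, h.1.2, h.2]

theorem eqUpToSign_iff {u v : Fin 3 → ℤ} : eqUpToSign u v ↔ u = v ∨ u = -v := by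
  simp [eqUpToSign, funext_iff, Fin.forall_fin_succ, and_assoc]

theorem symmetrize_congr {L L' : List (Fin 3 → ℤ)} (h : sameUpToSign L L') :
    symmetrize L = symmetrize L' := by
  have key : ∀ {L L' : List (Fin 3 → ℤ)}, (∀ u ∈ L, ∃ v ∈ L', u = v ∨ u = -v) →
      symmetrize L ⊆ symmetrize L' := by
    intro L L' h u hu
    rw [mem_symmetrize] at hu ⊢
    rcases hu with hu | hu
    · obtain ⟨v, hv, rfl | rfl⟩ := h _ hu
      · exact Or.inl hv
      · exact Or.inr (by simpa using hv)
    · obtain ⟨v, hv, h | h⟩ := h _ hu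
      · exact Or.inr (h ▸ hv)
      · exact Or.inl (neg_injective h ▸ hv)
  simp only [sameUpToSign, Bool.and_eq_true, List.all_eq_true, List.any_eq_true,
    eqUpToSign_iff] at h
  exact Finset.Subset.antisymm (key h.1) (key h.2)

theorem image_symmetrize (P : Matrix (Fin 3) (Fin 3) ℤ) (L : List (Fin 3 → ℤ)) :
    (symmetrize L).image (act P) = symmetrize (L.map (act P)) := by
  simp only [symmetrize, Finset.image_union, List.map_map]
  ext v
  simp only [Finset.mem_union, Finset.mem_image, List.mem_toFinset, List.mem_map,
    Function.comp_apply, exists_exists_and_eq_and, act_neg]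

/-- Every star is carried to the star of a model net by a matrix of `GL(3, ℤ)`. -/
theorem IsStar.exists_model {E : Finset (Fin 3 → ℤ)} (hE : IsStar E) :
    ∃ i, ∃ P : Matrix (Fin 3) (Fin 3) ℤ, IsUnit P.det ∧
      E.image (act P) = symmetrize (modelVectors i) := by
  induction hn : ∑ v ∈ E, weight v using Nat.strong_induction_on generalizing E with
  | _ n ih =>
    have h := List.all_eq_true.1 oddSublists_reduce _ hE.halfStar_mem_oddSublists
    simp only [Bool.or_eq_true, hE.not_nonSpanning] at h
    simp only [List.any_eq_true, Bool.false_eq_true, or_false] at h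
    rcases h with ⟨P, hP, h⟩ | ⟨P, hP, h⟩
    · have hu := isUnit_det_of_mem_reducers P (List.mem_cons_of_mem _ hP)
      simp only [lowersWeight, Bool.and_eq_true, List.all_eq_true, inUnitCube_iff,
        decide_eq_true_eq] at h
      have hE' : IsStar (E.image (act P)) := by
        refine hE.image hu fun v hv => ?_
        rw [← hE.symmetrize_halfStar, mem_symmetrize] at hv
        rcases hv with hv | hv
        · exact h.1 v hv
        · simpa [act_neg] using h.1 _ hv
      -- Weight is even, so the total over the star is twice that over its half; the drop on the
      -- list is a drop on the star.
      obtain ⟨i, Q, hQ, hi⟩ := ih (∑ v ∈ E.image (act P), weight v) (by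
        rw [← hn, Finset.sum_image (act_injective hu).injOn, hE.sum_eq _ weight_neg,
          hE.sum_eq (fun v => weight (act P v)) (by intro v; rw [act_neg, weight_neg])]
        simpa using h.2) hE' rfl
      refine ⟨i, Q * P, by rw [Matrix.det_mul]; exact hQ.mul hu, ?_⟩
      rw [← hi, Finset.image_image]
      exact congrArg (E.image ·) (funext fun v => act_mul Q P v)
    · simp only [reachesModel, List.any_eq_true] at h
      obtain ⟨i, _, hi⟩ := h
      refine ⟨i, P, isUnit_det_of_mem_reducers P hP, ?_⟩
      rw [← symmetrize_congr hi, ← image_symmetrize, hE.symmetrize_halfStar]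

/-! ### The determinant invariant -/

/-- The sum of the fourth powers of the determinants of all triples of members of a finite set. -/
def detPowerSumFinset (E : Finset (Fin 3 → ℤ)) : ℤ :=
  ∑ u ∈ E, ∑ v ∈ E, ∑ w ∈ E, det3 u v w ^ 4

/-- Each determinant is multiplied by `det P = ±1`, and the even power removes the sign. -/
theorem detPowerSumFinset_image (E : Finset (Fin 3 → ℤ)) {P : Matrix (Fin 3) (Fin 3) ℤ}
    (hP : IsUnit P.det) : detPowerSumFinset (E.image (act P)) = detPowerSumFinset E := by
  have h4 : P.det ^ 4 = 1 := by
    rcases Int.isUnit_iff.1 hP with h | h <;> rw [h] <;> norm_num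
  simp only [detPowerSumFinset, Finset.sum_image (act_injective hP).injOn, det3_act, mul_pow, h4,
    one_mul]

theorem detPowerSumFinset_symmetrize {L : List (Fin 3 → ℤ)} (hL : L.Nodup)
    (hpos : ∀ v ∈ L, 0 < code v) :
    detPowerSumFinset (symmetrize L) = 8 * detPowerSum L := by
  have e1 : ∀ u v w, det3 u v (-w) ^ 4 = det3 u v w ^ 4 := by
    intro u v w; simp only [det3, Pi.neg_apply]; ring
  have e2 : ∀ u v w, det3 u (-v) w ^ 4 = det3 u v w ^ 4 := by
    intro u v w; simp only [det3, Pi.neg_apply]; ring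
  have e3 : ∀ u v w, det3 (-u) v w ^ 4 = det3 u v w ^ 4 := by
    intro u v w; simp only [det3, Pi.neg_apply]; ring
  -- Each of the three summations contributes a factor 2, whence the 8.
  have s1 : ∀ u v, ∑ w ∈ symmetrize L, det3 u v w ^ 4 = 2 • (L.map fun w => det3 u v w ^ 4).sum :=
    fun u v => sum_symmetrize hL hpos _ (e1 u v)
  simp only [detPowerSumFinset, detPowerSum, s1]
  have s2 : ∀ u, ∑ v ∈ symmetrize L, 2 • (L.map fun w => det3 u v w ^ 4).sum =
      2 • (L.map fun v => 2 • (L.map fun w => det3 u v w ^ 4).sum).sum :=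
    fun u => sum_symmetrize hL hpos _ (by intro v; simp only [e2])
  simp only [s2]
  rw [sum_symmetrize hL hpos _ (by intro u; simp only [e3])]
  simp only [nsmul_eq_mul, List.sum_map_mul_left]
  push_cast
  ring

/-! ### The model vectors form stars -/

theorem modelVectors_nodup : ∀ i, (modelVectors i).Nodup := by decide +kernel

theorem modelVectors_subset_posVectors : ∀ i, ∀ v ∈ modelVectors i, v ∈ posVectors := by
  decide +kernel

theorem eq_of_image_symmetrize_modelVectors {i j : Fin 19} {P : Matrix (Fin 3) (Fin 3) ℤ}
    (hP : IsUnit P.det)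
    (h : (symmetrize (modelVectors i)).image (act P) = symmetrize (modelVectors j)) : i = j := by
  have h1 := detPowerSumFinset_image (symmetrize (modelVectors i)) hP
  have hpos : ∀ i, ∀ v ∈ modelVectors i, 0 < code v := fun i v hv =>
    code_pos_of_mem_posVectors v (modelVectors_subset_posVectors i v hv)
  rw [h, detPowerSumFinset_symmetrize (modelVectors_nodup j) (hpos j),
    detPowerSumFinset_symmetrize (modelVectors_nodup i) (hpos i)] at h1
  exact detPowerSum_injective (by simp only; omega)

theorem closure_eq_top_of_isUnit_det3 {S : Set (Fin 3 → ℤ)} {u v w : Fin 3 → ℤ} (hu : u ∈ S)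
    (hv : v ∈ S) (hw : w ∈ S) (h : IsUnit (det3 u v w)) : AddSubgroup.closure S = ⊤ := by
  rw [eq_top_iff]
  intro x _
  -- Cramer's rule, with the unit determinant as its own inverse, gives integral coefficients.
  have hd : det3 u v w * det3 u v w = 1 := by
    rcases Int.isUnit_iff.1 h with h | h <;> rw [h] <;> norm_num
  have hx : x = (det3 u v w * det3 x v w) • u + (det3 u v w * det3 u x w) • v +
      (det3 u v w * det3 u v x) • w := by
    have key : ∀ i, det3 u v w * x i = det3 x v w * u i + det3 u x w * v i + det3 u v x * w i := by
      intro i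
      fin_cases i <;> simp only [det3, Fin.zero_eta, Fin.mk_one, Fin.reduceFinMk] <;> ring
    ext i
    simp only [Pi.add_apply, Pi.smul_apply, smul_eq_mul]
    linear_combination (-x i) * hd + det3 u v w * key i
  rw [hx]
  have hm := fun {y} (hy : y ∈ S) => AddSubgroup.subset_closure hy
  exact add_mem (add_mem (zsmul_mem (hm hu) _) (zsmul_mem (hm hv) _)) (zsmul_mem (hm hw) _)

theorem isStar_symmetrize_modelVectors (i : Fin 19) : IsStar (symmetrize (modelVectors i)) where
  neg_mem v hv := by
    rw [mem_symmetrize] at hv ⊢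
    simpa using hv.symm
  abs_coord_le v hv := by
    rw [mem_symmetrize] at hv
    rcases hv with hv | hv
    · exact abs_le_of_mem_posVectors v (modelVectors_subset_posVectors i v hv)
    · simpa using abs_le_of_mem_posVectors _ (modelVectors_subset_posVectors i _ hv)
  ne_zero v hv h0 := by
    subst h0
    rw [mem_symmetrize, neg_zero, or_self] at hv
    exact absurd (code_pos_of_mem_posVectors 0 (modelVectors_subset_posVectors i _ hv))
      (by simp [code])
  eq_or_eq_neg u hu v hv h := by
    have key : ∀ i, ∀ u ∈ modelVectors i, ∀ v ∈ modelVectors i,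
        (2 : ℤ) ∣ u 0 - v 0 ∧ (2 : ℤ) ∣ u 1 - v 1 ∧ (2 : ℤ) ∣ u 2 - v 2 → u = v := by
      decide +kernel
    have key' : ∀ u ∈ modelVectors i, ∀ v ∈ modelVectors i,
        (∀ i, (2 : ℤ) ∣ u i - v i) → u = v := fun u hu v hv h =>
      key i u hu v hv ⟨h 0, h 1, h 2⟩
    rw [mem_symmetrize] at hu hv
    rcases hu with hu | hu <;> rcases hv with hv | hv
    · exact Or.inl (key' u hu v hv h)
    · right
      refine key' u hu _ hv fun i => ?_
      have := h i
      simp only [Pi.neg_apply]; omega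
    · right
      rw [← key' _ hu v hv fun i => ?_, neg_neg]
      have := h i
      simp only [Pi.neg_apply]; omega
    · left
      refine neg_injective (key' _ hu _ hv fun i => ?_)
      have := h i
      simp only [Pi.neg_apply]; omega
  closure_eq_top := by
    have key : ∀ i : Fin 19, ∃ u ∈ modelVectors i, ∃ v ∈ modelVectors i, ∃ w ∈ modelVectors i,
        det3 u v w = 1 ∨ det3 u v w = -1 := by decide +kernel
    obtain ⟨u, hu, v, hv, w, hw, h⟩ := key i
    exact closure_eq_top_of_isUnit_det3 (mem_symmetrize.2 (Or.inl hu))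
      (mem_symmetrize.2 (Or.inl hv)) (mem_symmetrize.2 (Or.inl hw)) (Int.isUnit_iff.2 h)

/-! ### Lattice nets in integer coordinates -/

theorem intPoint_injective : Function.Injective intPoint := fun k m h =>
  funext fun i => by simpa [intPoint] using congrFun h i

theorem intPoint_add (k m : Fin 3 → ℤ) : intPoint (k + m) = intPoint k + intPoint m := by
  ext i; simp [intPoint]

theorem intPoint_sub (k m : Fin 3 → ℤ) : intPoint (k - m) = intPoint k - intPoint m := by
  ext i; simp [intPoint]

theorem intPoint_zero : intPoint 0 = 0 := by
  ext i; simp [intPoint]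

theorem mulVec_intPoint (P : Matrix (Fin 3) (Fin 3) ℤ) (k : Fin 3 → ℤ) :
    (P.map (Int.cast : ℤ → ℝ)).mulVec (intPoint k) = intPoint (act P k) := by
  ext i
  simp [act_eq_mulVec, intPoint, Matrix.mulVec, dotProduct]

theorem mem_translationGroup {a : Module.Basis (Fin 3) ℝ Space} {t : Space} :
    t ∈ translationGroup a ↔ ∃ k : Fin 3 → ℤ, ∑ i, k i • a i = t := by
  rw [translationGroup, Submodule.mem_span_range_iff_exists_fun]

theorem sum_zsmul_basisFun (k : Fin 3 → ℤ) :
    ∑ i, k i • (Pi.basisFun ℝ (Fin 3)) i = intPoint k := by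
  ext j
  simp [intPoint, Pi.single_apply]

namespace Net

/-- The net with node set `ℤ³` in which each node `p` is joined to `p + v` for `v ∈ E`. -/
def latticeNet (E : Finset (Fin 3 → ℤ)) : Net where
  nodes := Set.range intPoint
  edges := {e | ∃ v ∈ E, ∃ k : Fin 3 → ℤ, e = s(intPoint k, intPoint (k + v))}

theorem modelNet_eq_latticeNet (i : Fin 19) :
    modelNet i = latticeNet (symmetrize (modelVectors i)) := by
  ext e
  · rfl
  · constructor
    · rintro ⟨l, hl, k, rfl⟩
      exact ⟨l.vec, mem_symmetrize.2 (Or.inl (List.mem_map_of_mem hl)), k, rfl⟩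
    · rintro ⟨v, hv, k, rfl⟩
      rcases mem_symmetrize.1 hv with hv | hv
      · obtain ⟨l, hl, rfl⟩ := List.mem_map.1 hv
        exact ⟨l, hl, k, rfl⟩
      · obtain ⟨l, hl, h⟩ := List.mem_map.1 hv
        exact ⟨l, hl, k + v, by rw [h, add_neg_cancel_right, Sym2.eq_swap]⟩

theorem mk_mem_edges_latticeNet {E : Finset (Fin 3 → ℤ)} (hE : ∀ v ∈ E, -v ∈ E)
    {k m : Fin 3 → ℤ} : s(intPoint k, intPoint m) ∈ (latticeNet E).edges ↔ m - k ∈ E := by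
  constructor
  · rintro ⟨v, hv, l, h⟩
    rcases Sym2.eq_iff.1 h with ⟨h1, h2⟩ | ⟨h1, h2⟩
    · rw [intPoint_injective h1, intPoint_injective h2, add_sub_cancel_left]
      exact hv
    · rw [intPoint_injective h1, intPoint_injective h2, sub_add_cancel_left]
      exact hE v hv
  · intro h
    exact ⟨m - k, h, k, by rw [add_sub_cancel]⟩

theorem segment_eq_of_sym2_eq {p q p' q' : Space} (h : s(p, q) = s(p', q')) :
    segment ℝ p q = segment ℝ p' q' := by
  rcases Sym2.eq_iff.1 h with ⟨rfl, rfl⟩ | ⟨rfl, rfl⟩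
  · rfl
  · exact segment_symm ℝ p q

end Net

/-! ### Bonds of a star meet only at endpoints -/

/-- Over the field with two elements, distinct nonzero vectors are linearly independent, so some 2×2
minor is nonzero. -/
theorem exists_odd_minor {u w : Fin 3 → ℤ} (hu : ¬ ∀ i, (2 : ℤ) ∣ u i)
    (hw : ¬ ∀ i, (2 : ℤ) ∣ w i) (huw : ¬ ∀ i, (2 : ℤ) ∣ u i - w i) :
    ∃ i j, ¬ (2 : ℤ) ∣ u i * w j - u j * w i := by
  have key : ∀ u w : Fin 3 → ZMod 2, (∀ i j, u i * w j - u j * w i = 0) →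
      (∀ i, u i = 0) ∨ (∀ i, w i = 0) ∨ ∀ i, u i - w i = 0 := by decide
  by_contra! h
  have h2 : ∀ a : ℤ, (2 : ℤ) ∣ a ↔ (a : ZMod 2) = 0 := fun a => by
    rw [ZMod.intCast_zmod_eq_zero_iff_dvd]; norm_cast
  simp only [h2] at hu hw huw h
  have := key (fun i => u i) (fun i => w i) (by simpa using h)
  push_cast at huw
  tauto

theorem exists_unit_minor {u w : Fin 3 → ℤ} (hu : ∀ i, |u i| ≤ 1) (hw : ∀ i, |w i| ≤ 1)
    (hu0 : u ≠ 0) (hw0 : w ≠ 0) (huw : ¬ ∀ i, (2 : ℤ) ∣ u i - w i) :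
    ∃ i j, IsUnit (u i * w j - u j * w i) := by
  have odd : ∀ {v : Fin 3 → ℤ}, (∀ i, |v i| ≤ 1) → v ≠ 0 → ¬ ∀ i, (2 : ℤ) ∣ v i := by
    intro v hv h0 h
    refine h0 (funext fun i => ?_)
    have h1 := abs_le.1 (hv i)
    have h2 := h i
    simp only [Pi.zero_apply]
    omega
  obtain ⟨i, j, h⟩ := exists_odd_minor (odd hu hu0) (odd hw hw0) huw
  -- The minor is a difference of two numbers of modulus at most 1, so being odd it is `±1`.
  have bound : ∀ a b : Fin 3, |u a * w b| ≤ 1 := fun a b => by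
    rw [abs_mul]; exact mul_le_one₀ (hu a) (abs_nonneg _) (hw b)
  have h1 := abs_le.1 (bound i j)
  have h2 := abs_le.1 (bound j i)
  refine ⟨i, j, Int.isUnit_iff.2 ?_⟩
  omega

/-- A real number in the unit interval that becomes an integer when multiplied by a unit of `ℤ` is
an endpoint. -/
theorem eq_zero_or_one_of_unit_mul {s : ℝ} (hs : s ∈ Set.Icc (0 : ℝ) 1) {c n : ℤ} (hc : IsUnit c)
    (h : s * c = n) : s = 0 ∨ s = 1 := by
  have key : ∀ n : ℤ, s = n → s = 0 ∨ s = 1 := by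
    rintro n rfl
    have h1 : (0 : ℤ) ≤ n := by exact_mod_cast hs.1
    have h2 : n ≤ (1 : ℤ) := by exact_mod_cast hs.2
    obtain rfl | rfl : n = 0 ∨ n = 1 := by omega
    · simp
    · simp
  rcases Int.isUnit_iff.1 hc with rfl | rfl
  · exact key n (by simpa using h)
  · exact key (-n) (by push_cast at h ⊢; linarith)

namespace IsStar

variable {E : Finset (Fin 3 → ℤ)}

theorem exists_isUnit_coord (hE : IsStar E) {u : Fin 3 → ℤ} (hu : u ∈ E) :
    ∃ i, IsUnit (u i) := by
  by_contra! h
  refine hE.ne_zero u hu (funext fun i => ?_)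
  have h1 := abs_le.1 (hE.abs_coord_le u hu i)
  have h2 := h i
  rw [Int.isUnit_iff] at h2
  simp only [Pi.zero_apply]
  omega

theorem mem_endpoints (hE : IsStar E) {k u m w : Fin 3 → ℤ} (hu : u ∈ E) (hw : w ∈ E)
    (hne : s(intPoint k, intPoint (k + u)) ≠ s(intPoint m, intPoint (m + w))) {x : Space}
    (hx : x ∈ segment ℝ (intPoint k) (intPoint (k + u)))
    (hx' : x ∈ segment ℝ (intPoint m) (intPoint (m + w))) :
    x ∈ s(intPoint k, intPoint (k + u)) ∧ x ∈ s(intPoint m, intPoint (m + w)) := by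
  rw [segment_eq_image'] at hx hx'
  obtain ⟨s, hs, rfl⟩ := hx
  obtain ⟨t, ht, hst⟩ := hx'
  simp only [intPoint_add, add_sub_cancel_left] at hst ⊢
  have hc : ∀ i, (m i : ℝ) + t * w i = k i + s * u i := fun i => congrFun hst i
  suffices h : (s = 0 ∨ s = 1) ∧ (t = 0 ∨ t = 1) by
    constructor
    · rcases h.1 with rfl | rfl <;> simp
    · rw [← hst]
      rcases h.2 with rfl | rfl <;> simp
  -- Congruent vectors of a star are parallel, so both bonds have the same direction; otherwise a
  -- unit minor determines the crossing.
  by_cases huw : ∀ i, (2 : ℤ) ∣ u i - w i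
  · obtain ⟨i, hi⟩ := hE.exists_isUnit_coord hu
    have hi2 : (u i : ℝ) * u i = 1 := by
      rcases Int.isUnit_iff.1 hi with h | h <;> rw [h] <;> norm_num
    rcases hE.eq_or_eq_neg u hu w hw huw with rfl | rfl
    · obtain ⟨n, hn⟩ : ∃ n : ℤ, s - t = n := by
        refine ⟨(m i - k i) * u i, ?_⟩
        push_cast
        linear_combination (-u i : ℝ) * hc i - (s - t) * hi2
      have hmk : m = k + n • u := by
        ext j
        have : (m j : ℝ) = k j + n * u j := by
          rw [← hn]; linear_combination hc j
        simpa using (by exact_mod_cast this : m j = k j + n * u j)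
      have h1 : (-1 : ℤ) ≤ n := by
        have : (-1 : ℝ) ≤ n := by rw [← hn]; linarith [hs.1, ht.2]
        exact_mod_cast this
      have h2 : n ≤ (1 : ℤ) := by
        have : (n : ℝ) ≤ 1 := by rw [← hn]; linarith [hs.2, ht.1]
        exact_mod_cast this
      -- The bonds are shifted along their common direction by `n` lengths. For `n = 0` they
      -- coincide, and for `n = ±1` they touch end to end.
      obtain rfl | rfl | rfl : n = -1 ∨ n = 0 ∨ n = 1 := by omega
      · push_cast at hn
        exact ⟨Or.inl (by linarith [hs.1, ht.2]), Or.inr (by linarith [hs.1, ht.2])⟩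
      · rw [zero_smul, add_zero] at hmk
        exact absurd (by rw [hmk]) hne
      · push_cast at hn
        exact ⟨Or.inr (by linarith [hs.2, ht.1]), Or.inl (by linarith [hs.2, ht.1])⟩
    · simp only [Pi.neg_apply, Int.cast_neg] at hc hi2
      obtain ⟨n, hn⟩ : ∃ n : ℤ, s + t = n := by
        refine ⟨(m i - k i) * -w i, ?_⟩
        push_cast
        linear_combination (w i : ℝ) * hc i - (s + t) * hi2
      have hmk : m = k + n • -w := by
        ext j
        have : (m j : ℝ) = k j - n * w j := by
          rw [← hn]; linear_combination hc j
        have : m j = k j - n * w j := by exact_mod_cast this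
        simp [this, sub_eq_add_neg]
      have h1 : (0 : ℤ) ≤ n := by
        have : (0 : ℝ) ≤ n := by rw [← hn]; linarith [hs.1, ht.1]
        exact_mod_cast this
      have h2 : n ≤ (2 : ℤ) := by
        have : (n : ℝ) ≤ 2 := by rw [← hn]; linarith [hs.2, ht.2]
        exact_mod_cast this
      -- With reversed direction the coincident case is `n = 1`.
      obtain rfl | rfl | rfl : n = 0 ∨ n = 1 ∨ n = 2 := by omega
      · push_cast at hn
        exact ⟨Or.inl (by linarith [hs.1, ht.1]), Or.inl (by linarith [hs.1, ht.1])⟩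
      · rw [one_smul] at hmk
        exact absurd (by rw [hmk, neg_add_cancel_right, Sym2.eq_swap]) hne
      · push_cast at hn
        exact ⟨Or.inr (by linarith [hs.2, ht.2]), Or.inr (by linarith [hs.2, ht.2])⟩
  · obtain ⟨i, j, hij⟩ := exists_unit_minor (hE.abs_coord_le u hu) (hE.abs_coord_le w hw) (hE.ne_zero u hu)
      (hE.ne_zero w hw) huw
    constructor
    · refine eq_zero_or_one_of_unit_mul hs hij (n := (m i - k i) * w j - (m j - k j) * w i) ?_
      push_cast
      linear_combination (w i : ℝ) * hc j - (w j : ℝ) * hc i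
    · refine eq_zero_or_one_of_unit_mul ht hij (n := (m i - k i) * u j - (m j - k j) * u i) ?_
      push_cast
      linear_combination (u i : ℝ) * hc j - (u j : ℝ) * hc i

theorem nonempty (hE : IsStar E) : E.Nonempty := by
  rw [Finset.nonempty_iff_ne_empty]
  rintro rfl
  have h := hE.closure_eq_top
  rw [Finset.coe_empty, AddSubgroup.closure_empty] at h
  exact bot_ne_top h

/-! ### The lattice net of a star is proper, periodic and connected -/

open Net

theorem isPeriodicityBasis_latticeNet :
    (latticeNet E).IsPeriodicityBasis (Pi.basisFun ℝ (Fin 3)) where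
  nodes_invariant := by
    rintro t ht _ ⟨k, rfl⟩
    obtain ⟨m, rfl⟩ := mem_translationGroup.1 ht
    exact ⟨m + k, by rw [intPoint_add, sum_zsmul_basisFun]⟩
  edges_invariant := by
    rintro t ht _ ⟨v, hv, k, rfl⟩
    obtain ⟨m, rfl⟩ := mem_translationGroup.1 ht
    refine ⟨v, hv, m + k, ?_⟩
    simp only [Sym2.map_mk, sum_zsmul_basisFun, ← intPoint_add, add_assoc]

theorem isProperLinearPeriodic_latticeNet (hE : IsStar E) :
    (latticeNet E).IsProperLinearPeriodic where
  countable_edges := by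
    have : (latticeNet E).edges =
        Set.range fun p : E × (Fin 3 → ℤ) => s(intPoint p.2, intPoint (p.2 + p.1)) := by
      ext e
      simp [latticeNet, eq_comm]
    rw [this]
    exact Set.countable_range _
  not_isDiag := by
    rintro _ ⟨v, hv, k, rfl⟩ h
    rw [Sym2.mk_isDiag_iff] at h
    exact hE.ne_zero v hv (by simpa using intPoint_injective h)
  essentially_disjoint := by
    rintro p q p' q' ⟨u, hu, k, h⟩ ⟨w, hw, m, h'⟩ hne x ⟨hx, hx'⟩
    rw [segment_eq_of_sym2_eq h] at hx
    rw [segment_eq_of_sym2_eq h'] at hx'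
    rw [h, h'] at hne
    rw [Set.mem_ofPred_eq, h, h']
    exact hE.mem_endpoints hu hw hne hx hx'
  nodes_eq := by
    ext x
    constructor
    · rintro ⟨k, rfl⟩
      obtain ⟨v, hv⟩ := hE.nonempty
      exact ⟨_, ⟨v, hv, k, rfl⟩, Sym2.mem_mk_left _ _⟩
    · rintro ⟨_, ⟨v, hv, k, rfl⟩, hx⟩
      rcases Sym2.mem_iff.1 hx with rfl | rfl
      exacts [⟨_, rfl⟩, ⟨_, rfl⟩]
  periodic := by
    refine ⟨Pi.basisFun ℝ (Fin 3), isPeriodicityBasis_latticeNet,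
      ⟨{intPoint 0}, Set.finite_singleton _, ?_, ?_⟩,
      ⟨(fun v => s(intPoint 0, intPoint (0 + v))) '' (E : Set (Fin 3 → ℤ)),
        E.finite_toSet.image _, ?_, ?_⟩⟩
    · rintro _ rfl
      exact ⟨0, rfl⟩
    · rintro _ ⟨k, rfl⟩
      exact ⟨_, rfl, intPoint k, mem_translationGroup.2 ⟨k, sum_zsmul_basisFun k⟩,
        by rw [intPoint_zero, add_zero]⟩
    · rintro _ ⟨v, hv, rfl⟩
      exact ⟨v, hv, 0, rfl⟩
    · rintro _ ⟨v, hv, k, rfl⟩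
      refine ⟨_, ⟨v, hv, rfl⟩, intPoint k, mem_translationGroup.2 ⟨k, sum_zsmul_basisFun k⟩, ?_⟩
      simp only [Sym2.map_mk, ← intPoint_add, add_zero, zero_add]

theorem connected_latticeNet (hE : IsStar E) : (latticeNet E).structureGraph.Connected := by
  let node : (Fin 3 → ℤ) → (latticeNet E).nodes := fun k => ⟨intPoint k, k, rfl⟩
  have key : ∀ x ∈ AddSubgroup.closure (E : Set (Fin 3 → ℤ)), ∀ k,
      (latticeNet E).structureGraph.Reachable (node k) (node (k + x)) := by
    intro x hx
    induction hx using AddSubgroup.closure_induction with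
    | mem x hx =>
      intro k
      refine SimpleGraph.Adj.reachable ?_
      refine ⟨⟨x, hx, k, rfl⟩, fun h => hE.ne_zero x hx ?_⟩
      simpa using intPoint_injective h
    | zero => intro k; rw [add_zero]
    | add x y _ _ hx hy => intro k; rw [← add_assoc]; exact (hx k).trans (hy _)
    | neg x _ hx =>
      intro k
      have := hx (k + -x)
      rw [neg_add_cancel_right] at this
      exact this.symm
  rw [SimpleGraph.connected_iff]
  refine ⟨?_, ⟨node 0⟩⟩
  rintro ⟨_, k, rfl⟩ ⟨_, m, rfl⟩
  have := key (m - k) (by rw [hE.closure_eq_top]; trivial) k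
  rwa [add_sub_cancel] at this

end IsStar

/-! ### Primitive bases and adjacency depth -/

namespace Net

variable {M : Net} {a b : Module.Basis (Fin 3) ℝ Space} {v : Space}

theorem IsNodeMotif.mem_nodes (hm : M.IsNodeMotif a {v}) : v ∈ M.nodes := hm.1 rfl

theorem IsNodeMotif.sub_mem (hm : M.IsNodeMotif a {v}) {x : Space} (hx : x ∈ M.nodes) :
    x - v ∈ translationGroup a := by
  obtain ⟨w, ⟨hw, h⟩, -⟩ := hm.2 x hx
  rwa [Set.mem_singleton_iff.1 hw] at h

/-- A period moves the node `v` to a node, and all nodes differ from `v` by elements of the group of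
`a`. -/
theorem IsNodeMotif.translationGroup_le (hm : M.IsNodeMotif a {v}) (hb : M.IsPeriodicityBasis b) :
    translationGroup b ≤ translationGroup a := by
  intro t ht
  simpa using hm.sub_mem (hb.nodes_invariant t ht v hm.mem_nodes)

theorem IsPeriodicityBasis.isPrimitiveBasis (ha : M.IsPeriodicityBasis a)
    (hm : M.IsNodeMotif a {v}) : M.IsPrimitiveBasis a :=
  ⟨ha, fun _ hb h => h.not_ge (hm.translationGroup_le hb)⟩

theorem IsPrimitiveBasis.translationGroup_eq (hb : M.IsPrimitiveBasis b)
    (ha : M.IsPeriodicityBasis a) (hm : M.IsNodeMotif a {v}) :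
    translationGroup b = translationGroup a :=
  (hm.translationGroup_le hb.1).eq_of_not_lt (hb.2 a ha)

/-- When some periodicity basis has a single class of nodes, every node motif of a primitive basis
is a singleton. -/
theorem IsPrimitiveBasis.motif_eq_singleton (hb : M.IsPrimitiveBasis b)
    (ha : M.IsPeriodicityBasis a) (hm : M.IsNodeMotif a {v}) {F : Set Space}
    (hF : M.IsNodeMotif b F) : ∃ w, F = {w} := by
  obtain ⟨w, ⟨hw, -⟩, -⟩ := hF.2 v hm.mem_nodes
  refine ⟨w, Set.eq_singleton_iff_unique_mem.2 ⟨hw, fun u hu => ?_⟩⟩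
  obtain ⟨z, -, hz⟩ := hF.2 u (hF.1 hu)
  rw [hz u ⟨hu, by simp⟩, hz w ⟨hw, ?_⟩]
  rw [hb.translationGroup_eq ha hm]
  simpa using sub_mem (hm.sub_mem (hF.1 hu)) (hm.sub_mem (hF.1 hw))

theorem IsProperLinearPeriodic.left_mem_nodes (hM : M.IsProperLinearPeriodic) {p q : Space}
    (h : s(p, q) ∈ M.edges) : p ∈ M.nodes := by
  rw [hM.nodes_eq]
  exact ⟨_, h, Sym2.mem_mk_left _ _⟩

/-- Some bond ends at `v`, and nondegeneracy makes its label nonzero. -/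
theorem IsProperLinearPeriodic.one_le_lqgDepth (hM : M.IsProperLinearPeriodic)
    (hm : M.IsNodeMotif a {v}) : 1 ≤ M.lqgDepth a {v} := by
  have hv := hm.mem_nodes
  rw [hM.nodes_eq] at hv
  obtain ⟨e, he, hve⟩ := hv
  obtain ⟨y, rfl⟩ := Sym2.mem_iff_exists.1 hve
  rw [Sym2.eq_swap] at he
  obtain ⟨k, hk⟩ := mem_translationGroup.1 (hm.sub_mem (hM.left_mem_nodes he))
  have hk0 : k ≠ 0 := by
    rintro rfl
    refine hM.not_isDiag _ he ?_
    rw [Sym2.mk_isDiag_iff]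
    simpa [eq_comm, sub_eq_zero] using hk
  obtain ⟨i, hi⟩ := Function.ne_iff.1 hk0
  have hmem : ((v, v, k) : Space × Space × (Fin 3 → ℤ)) ∈ M.lqgEdges a {v} :=
    ⟨rfl, rfl, by simpa only [hk, sub_add_cancel] using he⟩
  refine le_trans ?_ (le_iSup₂ (f := fun e (_ : e ∈ M.lqgEdges a {v}) =>
    ⨆ i : Fin 3, ((e.2.2 i).natAbs : ℕ∞)) _ hmem)
  refine le_trans ?_ (le_iSup (fun i : Fin 3 => ((k i).natAbs : ℕ∞)) i)
  exact_mod_cast Nat.one_le_iff_ne_zero.2 (Int.natAbs_ne_zero.2 hi)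

theorem abs_le_one_of_mem_lqgEdges {F : Set Space} (h : M.lqgDepth a F ≤ 1)
    {e : Space × Space × (Fin 3 → ℤ)} (he : e ∈ M.lqgEdges a F) (i : Fin 3) : |e.2.2 i| ≤ 1 := by
  have h1 : ((e.2.2 i).natAbs : ℕ∞) ≤ 1 :=
    (le_iSup (fun i : Fin 3 => ((e.2.2 i).natAbs : ℕ∞)) i).trans ((le_iSup₂ (f := fun e (_ : e ∈ M.lqgEdges a F) =>
      ⨆ i : Fin 3, ((e.2.2 i).natAbs : ℕ∞)) _ he).trans h)
  have h2 : (e.2.2 i).natAbs ≤ 1 := by exact_mod_cast h1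
  rw [Int.abs_eq_natAbs]
  exact_mod_cast h2

theorem isLatticeNet_and_adjacencyDepth_eq_one_iff (M : Net) :
    (M.IsLatticeNet ∧ M.adjacencyDepth = 1) ↔ M.HasSingleVertexDepthOneLQG := by
  constructor
  · rintro ⟨⟨hM, a, ha, v, hm⟩, hd⟩
    -- A strict bound on the infimum yields a basis and motif of depth below 2.
    have hlt : M.adjacencyDepth < 1 + 1 := by
      rw [hd]; norm_num
    simp only [adjacencyDepth, iInf_lt_iff] at hlt
    obtain ⟨b, hb, F, hF, h⟩ := hlt
    obtain ⟨w, rfl⟩ := hb.motif_eq_singleton ha.1 hm hF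
    exact ⟨hM, b, hb.1, w, hF, le_antisymm (Order.le_of_lt_add_one h) (hM.one_le_lqgDepth hF)⟩
  · rintro ⟨hM, a, ha, v, hm, hd⟩
    have hp := ha.isPrimitiveBasis hm
    refine ⟨⟨hM, a, hp, v, hm⟩, le_antisymm ?_ ?_⟩
    · exact (iInf₂_le_of_le a hp (iInf₂_le_of_le {v} hm le_rfl)).trans hd.le
    · refine le_iInf₂ fun b hb => le_iInf₂ fun F hF => ?_
      obtain ⟨w, rfl⟩ := hb.motif_eq_singleton ha hm hF
      exact hM.one_le_lqgDepth hF

theorem isConnectedDepthOneLatticeNet_iff (M : Net) : M.IsConnectedDepthOneLatticeNet ↔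
    M.HasSingleVertexDepthOneLQG ∧ M.structureGraph.Connected := by
  rw [← isLatticeNet_and_adjacencyDepth_eq_one_iff, IsConnectedDepthOneLatticeNet]
  tauto

end Net

theorem IsStar.isConnectedDepthOneLatticeNet {E : Finset (Fin 3 → ℤ)} (hE : IsStar E) :
    (Net.latticeNet E).IsConnectedDepthOneLatticeNet := by
  rw [Net.isConnectedDepthOneLatticeNet_iff]
  have hm : (Net.latticeNet E).IsNodeMotif (Pi.basisFun ℝ (Fin 3)) {intPoint 0} := by
    refine ⟨?_, ?_⟩
    · rintro _ rfl
      exact ⟨0, rfl⟩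
    · rintro _ ⟨k, rfl⟩
      refine ⟨_, ⟨rfl, mem_translationGroup.2 ⟨k, ?_⟩⟩, fun y hy => hy.1⟩
      rw [sum_zsmul_basisFun, intPoint_zero, sub_zero]
  refine ⟨⟨hE.isProperLinearPeriodic_latticeNet, _, isPeriodicityBasis_latticeNet, _, hm,
    le_antisymm ?_ (hE.isProperLinearPeriodic_latticeNet.one_le_lqgDepth hm)⟩,
    hE.connected_latticeNet⟩
  refine iSup₂_le ?_
  rintro ⟨x, y, k⟩ ⟨hx, hy, he⟩
  refine iSup_le fun i => ?_
  obtain rfl : x = intPoint 0 := hx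
  obtain rfl : y = intPoint 0 := hy
  simp only [sum_zsmul_basisFun, ← intPoint_add, add_zero] at he
  rw [Net.mk_mem_edges_latticeNet hE.neg_mem, zero_sub] at he
  have h := hE.abs_coord_le _ he i
  rw [Pi.neg_apply, abs_neg, Int.abs_eq_natAbs] at h
  exact_mod_cast h

/-! ### Affine equivalence and `GL(3, ℤ)` -/

namespace Net

variable {M : Net} {E E' : Finset (Fin 3 → ℤ)}

theorem map_latticeNet {P : Matrix (Fin 3) (Fin 3) ℤ} (hP : IsUnit P.det) :
    (latticeNet E).map (P.map (Int.cast : ℤ → ℝ)).mulVec = latticeNet (E.image (act P)) := by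
  have hs : ∀ k, ∃ m, act P m = k := fun k => ⟨act P⁻¹ k, by
    rw [← act_mul, Matrix.mul_nonsing_inv _ hP, act_one]⟩
  have hadd : ∀ k m, act P (k + m) = act P k + act P m := fun k m => by
    simp only [act_eq_mulVec, Matrix.mulVec_add]
  ext e
  · constructor
    · rintro ⟨_, ⟨k, rfl⟩, rfl⟩
      exact ⟨act P k, (mulVec_intPoint P k).symm⟩
    · rintro ⟨k, rfl⟩
      obtain ⟨m, rfl⟩ := hs k
      exact ⟨_, ⟨m, rfl⟩, mulVec_intPoint P m⟩
  · constructor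
    · rintro ⟨_, ⟨v, hv, k, rfl⟩, rfl⟩
      refine ⟨act P v, Finset.mem_image_of_mem _ hv, act P k, ?_⟩
      rw [Sym2.map_mk, mulVec_intPoint, mulVec_intPoint, hadd]
    · rintro ⟨w, hw, k, rfl⟩
      obtain ⟨v, hv, rfl⟩ := Finset.mem_image.1 hw
      obtain ⟨m, rfl⟩ := hs k
      refine ⟨_, ⟨v, hv, m, rfl⟩, ?_⟩
      rw [Sym2.map_mk, mulVec_intPoint, mulVec_intPoint, hadd]

/-- Equivalent lattice nets have stars that correspond under a matrix of `GL(3, ℤ)`. -/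
theorem OrientedAffineEquiv.exists_image_eq (hE : ∀ v ∈ E, -v ∈ E) (hE' : ∀ v ∈ E', -v ∈ E')
    (h : (latticeNet E).OrientedAffineEquiv (latticeNet E')) :
    ∃ P : Matrix (Fin 3) (Fin 3) ℤ, IsUnit P.det ∧ E.image (act P) = E' := by
  obtain ⟨X, hX, u, h⟩ := (orientedAffineEquiv_iff _ _).1 h
  have hnodes : ∀ x, (∃ k, X.mulVec (intPoint k) + u = x) ↔ ∃ m, intPoint m = x := by
    intro x
    have := congrArg (x ∈ ·.nodes) h
    simpa [map, latticeNet] using this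
  -- The translation part is the image of the node at the origin, hence an integer point.
  obtain ⟨u₀, rfl⟩ := (hnodes u).1 ⟨0, by rw [intPoint_zero, Matrix.mulVec_zero, zero_add]⟩
  have h1 : ∀ k, ∃ m, intPoint m = X.mulVec (intPoint k) := fun k => by
    obtain ⟨m, hm⟩ := (hnodes _).1 ⟨k, rfl⟩
    exact ⟨m - u₀, by rw [intPoint_sub, hm, add_sub_cancel_right]⟩
  have h2 : ∀ m, ∃ k, X.mulVec (intPoint k) = intPoint m := fun m => by
    obtain ⟨k, hk⟩ := (hnodes _).2 ⟨m + u₀, rfl⟩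
    exact ⟨k, by rw [intPoint_add] at hk; exact add_right_cancel hk⟩
  have hsingle : ∀ j, intPoint (Pi.single j 1) = Pi.single j 1 := fun j => by
    ext i; simp [intPoint, Pi.single_apply]
  -- Images of the unit vectors are the columns of `P`; their preimages are the columns of an
  -- integral inverse `Q`.
  choose p hp using fun j : Fin 3 => h1 (Pi.single j 1)
  choose q hq using fun j : Fin 3 => h2 (Pi.single j 1)
  let P : Matrix (Fin 3) (Fin 3) ℤ := Matrix.of fun i j => p j i
  let Q : Matrix (Fin 3) (Fin 3) ℤ := Matrix.of fun i j => q j i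
  have hPX : P.map (Int.cast : ℤ → ℝ) = X := by
    ext i j
    have := congrFun (hp j) i
    rw [hsingle, Matrix.mulVec_single_one] at this
    simpa [P, intPoint] using this
  have hact : ∀ k, X.mulVec (intPoint k) = intPoint (act P k) := fun k => by
    rw [← hPX, mulVec_intPoint]
  have hPQ : P * Q = 1 := by
    ext i j
    have h3 : act P (q j) = Pi.single j 1 := intPoint_injective (by rw [← hact, hq])
    rw [act_eq_mulVec] at h3
    have h4 := congrFun h3 i
    rw [Matrix.one_apply, ← Pi.single_apply j (1 : ℤ) i, ← h4]
    rfl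
  have hP : IsUnit P.det := IsUnit.of_mul_eq_one Q.det (by
    rw [← Matrix.det_mul, hPQ, Matrix.det_one])
  refine ⟨P, hP, ?_⟩
  have hinj : Function.Injective fun x => X.mulVec x + intPoint u₀ := fun x y hxy =>
    Matrix.mulVec_injective_of_isUnit ((Matrix.isUnit_iff_isUnit_det X).2 hX.ne'.isUnit)
      (add_right_cancel hxy)
  have hstar : ∀ v, v ∈ E ↔ act P v ∈ E' := by
    intro v
    have h5 : s(intPoint 0, intPoint v) ∈ (latticeNet E).edges ↔
        s(intPoint u₀, intPoint (act P v + u₀)) ∈ (latticeNet E').edges := by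
      rw [← h, intPoint_add, ← hact]
      constructor
      · intro hv
        refine ⟨_, hv, ?_⟩
        rw [Sym2.map_mk, intPoint_zero, Matrix.mulVec_zero, zero_add]
      · rintro ⟨e, he, hev⟩
        convert he
        refine Sym2.map.injective hinj ?_
        rw [hev, Sym2.map_mk, intPoint_zero, Matrix.mulVec_zero, zero_add]
    rwa [mk_mem_edges_latticeNet hE, mk_mem_edges_latticeNet hE', sub_zero,
      add_sub_cancel_right] at h5
  ext w
  rw [Finset.mem_image]
  constructor
  · rintro ⟨v, hv, rfl⟩
    exact (hstar v).1 hv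
  · intro hw
    have hw' : act P (act P⁻¹ w) = w := by
      rw [← act_mul, Matrix.mul_nonsing_inv _ hP, act_one]
    exact ⟨_, (hstar _).2 (by rwa [hw']), hw'⟩

/-! ### From nets to stars and models -/

/-- A connected depth one lattice net is an affine image of the lattice net of a star. -/
theorem IsConnectedDepthOneLatticeNet.exists_isStar (hM : M.IsConnectedDepthOneLatticeNet) :
    ∃ E, IsStar E ∧ ∃ A : Matrix (Fin 3) (Fin 3) ℝ, A.det ≠ 0 ∧ ∃ v : Space,
      M = (latticeNet E).map fun x => A.mulVec x + v := by
  obtain ⟨⟨hM, a, ha, v, hm, hd⟩, hc⟩ := (isConnectedDepthOneLatticeNet_iff M).1 hM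
  let A : Matrix (Fin 3) (Fin 3) ℝ := Matrix.of fun i j => a j i
  have hAe : A = (Pi.basisFun ℝ (Fin 3)).toMatrix a := by
    ext i j; simp [A, Module.Basis.toMatrix_apply]
  have hA : A.det ≠ 0 := by
    have := (Pi.basisFun ℝ (Fin 3)).isUnit_det a
    rw [Module.Basis.det_apply, ← hAe] at this
    exact this.ne_zero
  let φ : Space → Space := fun x => A.mulVec x + v
  have hφ : ∀ k, φ (intPoint k) = ∑ i, k i • a i + v := by
    intro k
    ext i
    simp [φ, A, Matrix.mulVec, dotProduct, intPoint, mul_comm]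
  have hφinj : Function.Injective φ := fun x y hxy =>
    Matrix.mulVec_injective_of_isUnit ((Matrix.isUnit_iff_isUnit_det A).2 hA.isUnit)
      (add_right_cancel hxy)
  have hφadd : ∀ k m, φ (intPoint (k + m)) = ∑ i, k i • a i + φ (intPoint m) := by
    intro k m
    rw [hφ, hφ, ← add_assoc, ← Finset.sum_add_distrib]
    simp only [Pi.add_apply, add_smul]
  have hnodes : ∀ x, x ∈ M.nodes ↔ ∃ k, φ (intPoint k) = x := by
    intro x
    constructor
    · intro hx
      obtain ⟨k, hk⟩ := mem_translationGroup.1 (hm.sub_mem hx)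
      exact ⟨k, by rw [hφ, hk, sub_add_cancel]⟩
    · rintro ⟨k, rfl⟩
      rw [hφ]
      exact ha.nodes_invariant _ (mem_translationGroup.2 ⟨k, rfl⟩) v hm.mem_nodes
  have htrans : ∀ l k m, s(φ (intPoint k), φ (intPoint m)) ∈ M.edges →
      s(φ (intPoint (l + k)), φ (intPoint (l + m))) ∈ M.edges := by
    intro l k m h
    rw [hφadd, hφadd]
    simpa using ha.edges_invariant _ (mem_translationGroup.2 ⟨l, rfl⟩) _ h
  classical
  -- Restricting to the cube makes `E` finite; `hmemE` uses the depth to show that no edge vector is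
  -- lost.
  let E : Finset (Fin 3 → ℤ) := (Fintype.piFinset fun _ => Finset.Icc (-1) 1).filter
    fun k => s(φ (intPoint k), φ (intPoint 0)) ∈ M.edges
  have hmemE : ∀ k, k ∈ E ↔ s(φ (intPoint k), φ (intPoint 0)) ∈ M.edges := by
    intro k
    rw [Finset.mem_filter, and_iff_right_iff_imp, Fintype.mem_piFinset]
    intro h i
    rw [Finset.mem_Icc, ← abs_le]
    refine abs_le_one_of_mem_lqgEdges (e := (v, v, k)) hd.le ⟨rfl, rfl, ?_⟩ i
    simpa [hφ] using h
  have hedge : ∀ k m, s(φ (intPoint k), φ (intPoint m)) ∈ M.edges ↔ k - m ∈ E := by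
    intro k m
    rw [hmemE]
    constructor
    · intro h
      simpa [sub_eq_neg_add] using htrans (-m) _ _ h
    · intro h
      simpa using htrans m _ _ h
  have hstar : IsStar E := by
    have hneg : ∀ u ∈ E, -u ∈ E := by
      intro u hu
      rw [← sub_zero u, ← hedge, Sym2.eq_swap, hedge, zero_sub] at hu
      exact hu
    have hne : ∀ u ∈ E, u ≠ 0 := by
      rintro u hu rfl
      exact hM.not_isDiag _ ((hmemE 0).1 hu) (Sym2.mk_isDiag_iff.2 rfl)
    refine ⟨hneg, ?_, hne, ?_, ?_⟩
    · intro u hu i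
      have := Fintype.mem_piFinset.1 (Finset.mem_filter.1 hu).1 i
      rwa [Finset.mem_Icc, ← abs_le] at this
    · intro u hu w hw h
      -- Here `u - w = 2c`.
      choose c hc using h
      by_contra! hne'
      -- the bonds from `0` to `u` and from `c` to `c + w` have the same midpoint
      have hmid : ∀ k l : Fin 3 → ℤ, φ ((2⁻¹ : ℝ) • (intPoint k + intPoint l)) ∈
          segment ℝ (φ (intPoint k)) (φ (intPoint l)) := by
        intro k l
        refine ⟨2⁻¹, 2⁻¹, by norm_num, by norm_num, by norm_num, ?_⟩
        simp only [φ, Matrix.mulVec_smul, Matrix.mulVec_add]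
        module
      have huc : u = c + (c + w) := by
        ext i
        have := hc i
        simp only [Pi.add_apply]; omega
      have hx1 := hmid u 0
      have hx2 := hmid (c + w) c
      rw [← intPoint_add] at hx1 hx2
      rw [add_comm (c + w) c, ← huc] at hx2
      rw [add_zero] at hx1
      have hd1 : s(φ (intPoint u), φ (intPoint 0)) ∈ M.edges := (hmemE u).1 hu
      have hd2 : s(φ (intPoint (c + w)), φ (intPoint c)) ∈ M.edges := by
        rw [hedge]; simpa using hw
      have hne2 : s(φ (intPoint u), φ (intPoint 0)) ≠ s(φ (intPoint (c + w)), φ (intPoint c)) := by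
        intro h
        rcases Sym2.eq_iff.1 h with ⟨h1, h2⟩ | ⟨h1, h2⟩
        · have e2 := intPoint_injective (hφinj h2)
          refine hne'.1 ?_
          rw [huc, ← e2, zero_add, zero_add]
        · have e1 := intPoint_injective (hφinj h1)
          have e2 := intPoint_injective (hφinj h2)
          refine hne'.2 ?_
          rw [e1, eq_neg_iff_add_eq_zero, ← e2]
      -- The common midpoint would have to be an endpoint of the first bond, forcing `u = 0`.
      have hend := (hM.essentially_disjoint _ _ _ _ hd1 hd2 hne2 ⟨hx1, hx2⟩).1
      refine hne u hu (intPoint_injective ?_)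
      rw [intPoint_zero]
      rcases Sym2.mem_iff.1 hend with h | h
      · have h3 := hφinj h
        have h4 : (2⁻¹ : ℝ) • intPoint u = 0 := by
          calc (2⁻¹ : ℝ) • intPoint u = intPoint u - (2⁻¹ : ℝ) • intPoint u := by module
            _ = 0 := by rw [h3, sub_self]
        exact (smul_eq_zero.1 h4).resolve_left (by norm_num)
      · have h3 := hφinj h
        rw [intPoint_zero] at h3
        exact (smul_eq_zero.1 h3).resolve_left (by norm_num)
    · rw [eq_top_iff]
      intro x _
      -- Along a path, the displacement is a sum of edge vectors.
      have key : ∀ y z : M.nodes, M.structureGraph.Reachable y z → ∀ k m,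
          φ (intPoint k) = y → φ (intPoint m) = z →
            k - m ∈ AddSubgroup.closure (E : Set (Fin 3 → ℤ)) := by
        rintro y z ⟨p⟩
        induction p with
        | nil =>
          intro k m hk hm
          rw [intPoint_injective (hφinj (hk.trans hm.symm)), sub_self]
          exact zero_mem _
        | @cons y z w hyz _ ih =>
          intro k m hk hm
          obtain ⟨l, hl⟩ := (hnodes z).1 z.2
          have h : s((y : Space), (z : Space)) ∈ M.edges := hyz.1
          rw [← hk, ← hl, hedge] at h
          rw [← sub_add_sub_cancel k l m]
          exact add_mem (AddSubgroup.subset_closure h) (ih l m hl hm)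
      have := key ⟨_, (hnodes _).2 ⟨x, rfl⟩⟩ ⟨_, (hnodes _).2 ⟨0, rfl⟩⟩ (hc.preconnected _ _)
        x 0 rfl rfl
      rwa [sub_zero] at this
  refine ⟨E, hstar, A, hA, v, ?_⟩
  ext e
  · rw [hnodes]
    simp [map, latticeNet, φ]
  · constructor
    · intro he
      induction e using Sym2.ind with
      | _ x y =>
        obtain ⟨k, rfl⟩ := (hnodes x).1 (hM.left_mem_nodes he)
        obtain ⟨m, rfl⟩ := (hnodes y).1 (hM.left_mem_nodes (Sym2.eq_swap ▸ he))
        refine ⟨s(intPoint k, intPoint m), ?_, rfl⟩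
        rw [Sym2.eq_swap, mk_mem_edges_latticeNet hstar.neg_mem, ← hedge]
        exact he
    · rintro ⟨_, ⟨u, hu, k, rfl⟩, rfl⟩
      rw [Sym2.map_mk, Sym2.eq_swap]
      exact (hedge _ _).2 (by rwa [add_sub_cancel_left])

theorem IsConnectedDepthOneLatticeNet.exists_modelNet (hM : M.IsConnectedDepthOneLatticeNet) :
    ∃ i : Fin 19, M.OrientedAffineEquiv (modelNet i) := by
  obtain ⟨E, hE, A, hA, v, rfl⟩ := hM.exists_isStar
  obtain ⟨i, P, hP, hPE⟩ := hE.exists_model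
  -- Replacing `P` by `-P` flips the determinant, the dimension being odd, and leaves the image of
  -- the symmetric set `E` unchanged. So the sign can be matched to that of `det A`.
  obtain ⟨Q, hQ, hQE, hQA⟩ : ∃ Q : Matrix (Fin 3) (Fin 3) ℤ, IsUnit Q.det ∧
      E.image (act Q) = symmetrize (modelVectors i) ∧ 0 < (Q.det : ℝ) * A.det := by
    have hcast : (P.det : ℝ) ≠ 0 := by exact_mod_cast hP.ne_zero
    rcases lt_or_gt_of_ne (mul_ne_zero hcast hA) with h | h
    · have hdet : (-P).det = -P.det := by simp [Matrix.det_neg]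
      refine ⟨-P, by rw [hdet]; exact hP.neg, ?_, by rw [hdet, Int.cast_neg, neg_mul]; exact neg_pos.2 h⟩
      rw [← hPE]
      ext w
      simp only [Finset.mem_image]
      constructor <;> rintro ⟨u, hu, rfl⟩ <;>
        exact ⟨-u, hE.neg_mem u hu, by simp [act_eq_mulVec, Matrix.mulVec_neg, Matrix.neg_mulVec]⟩
    · exact ⟨P, hP, hPE, h⟩
  refine ⟨i, (orientedAffineEquiv_iff _ _).2 ⟨Q.map (Int.cast : ℤ → ℝ) * A⁻¹, ?_,
    -(Q.map (Int.cast : ℤ → ℝ) * A⁻¹).mulVec v, ?_⟩⟩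
  · have hdet : (Q.map (Int.cast : ℤ → ℝ)).det = Q.det := by
      simpa using (RingHom.map_det (Int.castRingHom ℝ) Q).symm
    rw [Matrix.det_mul, Matrix.det_nonsing_inv, Ring.inverse_eq_inv', hdet, ← div_eq_mul_inv]
    exact div_pos_iff.2 (mul_pos_iff.1 hQA)
  · rw [modelNet_eq_latticeNet, ← hQE, ← map_latticeNet hQ, map_map]
    congr 1
    funext x
    simp [Function.comp, Matrix.mulVec_add, Matrix.mul_assoc,
      Matrix.nonsing_inv_mul _ hA.isUnit]

end Net

/-! ### The classification -/

theorem isConnectedDepthOneLatticeNet_modelNet (i : Fin 19) :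
    (modelNet i).IsConnectedDepthOneLatticeNet := by
  rw [Net.modelNet_eq_latticeNet]
  exact (isStar_symmetrize_modelVectors i).isConnectedDepthOneLatticeNet

theorem eq_of_orientedAffineEquiv_modelNet {i j : Fin 19}
    (h : (modelNet i).OrientedAffineEquiv (modelNet j)) : i = j := by
  rw [Net.modelNet_eq_latticeNet, Net.modelNet_eq_latticeNet] at h
  obtain ⟨P, hP, hPE⟩ := h.exists_image_eq (isStar_symmetrize_modelVectors i).neg_mem
    (isStar_symmetrize_modelVectors j).neg_mem
  exact eq_of_image_symmetrize_modelVectors hP hPE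

/-- There are exactly 19 oriented affine equivalence classes of connected lattice nets of adjacency
depth 1; the 19 model nets are such nets and represent every class exactly once. The lattice nets
of adjacency depth 1 are the proper linear 3-periodic nets with a single-vertex depth-1 labelled
quotient graph. -/
theorem theorem8p6 :
    (∀ M : Net, (M.IsLatticeNet ∧ M.adjacencyDepth = 1) ↔ M.HasSingleVertexDepthOneLQG) ∧
    (Quotient.mk Net.orientedAffineSetoid ''
      {M : Net | M.IsConnectedDepthOneLatticeNet}).ncard = 19 ∧
    (∀ i : Fin 19, (modelNet i).IsConnectedDepthOneLatticeNet) ∧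
    (∀ i j : Fin 19, (modelNet i).OrientedAffineEquiv (modelNet j) → i = j) ∧
    (∀ M : Net, M.IsConnectedDepthOneLatticeNet →
      ∃ i : Fin 19, M.OrientedAffineEquiv (modelNet i)) := by
  refine ⟨Net.isLatticeNet_and_adjacencyDepth_eq_one_iff, ?_,
    isConnectedDepthOneLatticeNet_modelNet, fun i j => eq_of_orientedAffineEquiv_modelNet,
    fun M hM => hM.exists_modelNet⟩
  have himage : Quotient.mk Net.orientedAffineSetoid '' {M : Net | M.IsConnectedDepthOneLatticeNet}
      = Set.range fun i => Quotient.mk Net.orientedAffineSetoid (modelNet i) := by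
    ext c
    constructor
    · rintro ⟨M, hM, rfl⟩
      obtain ⟨i, hi⟩ := Net.IsConnectedDepthOneLatticeNet.exists_modelNet hM
      exact ⟨i, (Quotient.sound hi).symm⟩
    · rintro ⟨i, rfl⟩
      exact ⟨_, isConnectedDepthOneLatticeNet_modelNet i, rfl⟩
  have hinj : Function.Injective fun i => Quotient.mk Net.orientedAffineSetoid (modelNet i) :=
    fun i j hij => eq_of_orientedAffineEquiv_modelNet (Quotient.exact hij)
  rw [himage, ← Set.image_univ, Set.ncard_image_of_injective _ hinj, Set.ncard_univ,
    Nat.card_eq_fintype_card, Fintype.card_fin]
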